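/- **Proposition 6.5 (weak IDT $\Leftrightarrow$ 1-Lévy).** Let $X=(X_t;\,t\ge 0)$ be an $\mathbb{R}^d$-valued stochastic process which is stochastically continuous, i.e. $X_s\to X_t$ in probability as $s\to t$, for every $t\ge 0$. Call $X$ *weakly IDT* if for every integer $n\ge 1$ and every fixed $t\ge 0$ $$X_{nt}\stackrel{(law)}{=}X_t^{1}+\cdots+X_t^{n},$$ where $X_t^1,\dots,X_t^n$ are independent copies of $X_t$. Call $X$ a *1-Lévy process* if there is a Lévy process $Y=(Y_t;\,t\ge 0)$ in $\mathbb{R}^d$, possibly on another probability space, such that $X_t\stackrel{(law)}{=}Y_t$ for every fixed $t\ge 0$. Here a *Lévy process* is a process with $Y_0=0$ almost surely, with independent and stationary increments, stochastically continuous, and with almost surely càdlàg paths. Then: 1. $X$ is weakly IDT if and only if it is a 1-Lévy process. 2. If $X$ is weakly IDT, then for all $s,t\ge 0$ $$X_{s+t}\stackrel{(law)}{=}X_s+X'_t,$$ where $X'$ is an independent copy of $X$. -/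

import Mathlib

open MeasureTheory ProbabilityTheory Filter Topology
open scoped NNReal

universe u v w

/-- The process `X` is continuous in probability at every time `t ≥ 0`. -/
def StochasticallyContinuous {Ω E : Type*} [MeasurableSpace Ω] [PseudoEMetricSpace E]
    (X : ℝ≥0 → Ω → E) (P : Measure Ω) : Prop :=
  ∀ t : ℝ≥0, TendstoInMeasure P X (𝓝 t) (X t)

/-- A path is càdlàg: right-continuous with (finite) left limits. At `t = 0` the left-limit
condition is void, since `𝓝[<] (0 : ℝ≥0) = ⊥`. -/
def IsCadlagPath {E : Type*} [TopologicalSpace E] (x : ℝ≥0 → E) : Prop :=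
  ∀ t : ℝ≥0, ContinuousWithinAt x (Set.Ici t) t ∧ ∃ l : E, Tendsto x (𝓝[<] t) (𝓝 l)

/-- A Lévy process: a family of random vectors, starting at `0` almost surely, with independent
and stationary increments, continuous in probability, and with almost surely càdlàg paths. -/
structure IsLevyProcess {Ω E : Type*} [MeasurableSpace Ω] [NormedAddCommGroup E]
    [MeasurableSpace E] (Y : ℝ≥0 → Ω → E) (P : Measure Ω) : Prop where
  measurable : ∀ t, Measurable (Y t)
  zero_ae : ∀ᵐ ω ∂P, Y 0 ω = 0
  indepIncrements : HasIndepIncrements Y P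
  stationaryIncrements : ∀ s t : ℝ≥0,
    IdentDistrib (fun ω ↦ Y (s + t) ω - Y s ω) (fun ω ↦ Y t ω - Y 0 ω) P P
  stochasticallyContinuous : StochasticallyContinuous Y P
  cadlag : ∀ᵐ ω ∂P, IsCadlagPath (fun t ↦ Y t ω)

/-- The processes `X` and `Y`, possibly living on different probability spaces, are associated:
they have the same one-dimensional marginal distributions. -/
def AreAssociated {Ω Ω' E : Type*} [MeasurableSpace Ω] [MeasurableSpace Ω'] [MeasurableSpace E]
    (X : ℝ≥0 → Ω → E) (P : Measure Ω) (Y : ℝ≥0 → Ω' → E) (Q : Measure Ω') : Prop :=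
  ∀ t : ℝ≥0, IdentDistrib (X t) (Y t) P Q

/-- `X` is weakly IDT: for every `n ≥ 1` and every fixed `t ≥ 0`, the random vector `X_{nt}` has
the law of `X_t¹ + ⋯ + X_tⁿ`, where the `X_tⁱ` are independent copies of `X_t`. The copies are
realized on the `n`-fold product of the probability space as `ω ↦ X_t (ω i)`, `i : Fin n`. -/
def IsWeaklyIDT {Ω E : Type*} [MeasurableSpace Ω] [AddCommMonoid E] [MeasurableSpace E]
    (X : ℝ≥0 → Ω → E) (P : Measure Ω) : Prop :=
  ∀ n : ℕ, 1 ≤ n → ∀ t : ℝ≥0,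
    IdentDistrib (X ((n : ℝ≥0) * t)) (fun ω : Fin n → Ω ↦ ∑ i, X t (ω i))
      P (Measure.pi fun _ : Fin n ↦ P)

/-- `X` is a 1-Lévy process: there is a Lévy process, on some probability space, which is
associated to `X`. -/
def IsOneLevy {Ω : Type u} {E : Type w} [MeasurableSpace Ω] [NormedAddCommGroup E]
    [MeasurableSpace E] (X : ℝ≥0 → Ω → E) (P : Measure Ω) : Prop :=
  ∃ (Ω' : Type v) (_ : MeasurableSpace Ω') (Q : Measure Ω') (_ : IsProbabilityMeasure Q)
    (Y : ℝ≥0 → Ω' → E), IsLevyProcess Y Q ∧ AreAssociated X P Y Q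

section JumpCount

variable {E : Type*}

open Classical in
/-- The number of moves of length greater than `b` seen along a list of points, where the
current point is compared with an anchor `c` that is updated after each such move. -/
noncomputable def jumpCount [Dist E] (b : ℝ) : E → List E → ℕ
  | _, [] => 0
  | c, y :: ys => if b < dist c y then jumpCount b y ys + 1 else jumpCount b c ys

lemma chain_length_le_jumpCount_aux [PseudoMetricSpace E] {b : ℝ} (hb : 0 ≤ b) (ys : List E) :
    (∀ (c : E) (l : List E), l.Sublist ys → l.IsChain (fun x y ↦ 2 * b < dist x y) →
      l.length ≤ jumpCount b c ys + 1) ∧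
    (∀ (c z : E) (l : List E), dist c z ≤ b → l.Sublist ys →
      (z :: l).IsChain (fun x y ↦ 2 * b < dist x y) →
      l.length ≤ jumpCount b c ys) := by
  induction ys with
  | nil =>
    refine ⟨fun c l hl _ ↦ ?_, fun c z l _ hl _ ↦ ?_⟩ <;> simp [List.sublist_nil.1 hl]
  | cons y ys ih =>
    obtain ⟨ihA, ihB⟩ := ih
    refine ⟨fun c l hl hc ↦ ?_, fun c z l hz hl hc ↦ ?_⟩
    · simp only [jumpCount]
      cases hl with
      | cons _ hl =>
        split_ifs
        · exact (ihA y l hl hc).trans (Nat.le_succ _)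
        · exact ihA c l hl hc
      | cons_cons _ hl =>
        rename_i l'
        rw [List.length_cons, Nat.add_le_add_iff_right]
        split_ifs with h
        · exact (ihB y y l' (by simpa using hb) hl hc).trans (Nat.le_succ _)
        · exact ihB c y l' (not_lt.1 h) hl hc
    · simp only [jumpCount]
      cases hl with
      | cons _ hl =>
        split_ifs
        · exact ihA y l hl hc.of_cons
        · exact ihB c z l hz hl hc
      | cons_cons _ hl =>
        rename_i l'
        have h1 : 2 * b < dist z y := hc.rel
        have h2 := dist_triangle z c y
        rw [dist_comm z c] at h2
        rw [if_pos (by linarith), List.length_cons, Nat.add_le_add_iff_right]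
        exact ihB y y l' (by simpa using hb) hl hc.of_cons

/-- A list of points along which consecutive distances are greater than `2 * b`, extracted from
a list `ys`, is at most one longer than the number of moves counted along `ys`. -/
lemma chain_length_le_jumpCount [PseudoMetricSpace E] {b : ℝ} (hb : 0 ≤ b) (c : E)
    {l ys : List E} (hl : l.Sublist ys) (hc : l.IsChain (fun x y ↦ 2 * b < dist x y)) :
    l.length ≤ jumpCount b c ys + 1 :=
  (chain_length_le_jumpCount_aux hb ys).1 c l hl hc

/-- The successive positions, after the first one, of the walk with given start and increments. -/
def walkFrom [Add E] : E → List E → List E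
  | _, [] => []
  | s, y :: ys => (s + y) :: walkFrom (s + y) ys

lemma walkFrom_ofFn_sum [AddCommMonoid E] (x : ℕ → E) (k n : ℕ) :
    walkFrom (∑ i ∈ Finset.range k, x i) (List.ofFn fun i : Fin n ↦ x (k + i)) =
      (List.range' (k + 1) n).map fun j ↦ ∑ i ∈ Finset.range j, x i := by
  induction n generalizing k with
  | zero => simp [walkFrom]
  | succ n ih =>
    have h := ih (k + 1)
    simp only [List.ofFn_succ, walkFrom, Fin.val_zero, add_zero, Fin.val_succ,
      ← Finset.sum_range_succ, List.range'_succ, List.map_cons]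
    rw [← h]
    simp only [add_comm, add_left_comm]

end JumpCount

section Ottaviani

variable {E : Type*} [NormedAddCommGroup E] [MeasurableSpace E] [BorelSpace E]
  [SecondCountableTopology E]

lemma measurable_jumpCount_walkFrom (b : ℝ) (n : ℕ) :
    Measurable fun p : E × E × (Fin n → E) ↦
      jumpCount b p.1 (walkFrom p.2.1 (List.ofFn p.2.2)) := by
  induction n with
  | zero => simp [walkFrom, jumpCount]
  | succ n ih =>
    simp only [List.ofFn_succ, walkFrom, jumpCount]
    refine Measurable.ite ?_ ?_ ?_
    · exact measurableSet_lt measurable_const (by fun_prop)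
    · have : Measurable fun p : E × E × (Fin (n + 1) → E) ↦
        (p.2.1 + p.2.2 0, p.2.1 + p.2.2 0, fun i : Fin n ↦ p.2.2 i.succ) := by fun_prop
      exact (ih.comp this).add_const 1
    · have : Measurable fun p : E × E × (Fin (n + 1) → E) ↦
        (p.1, p.2.1 + p.2.2 0, fun i : Fin n ↦ p.2.2 i.succ) := by fun_prop
      exact ih.comp this

omit [BorelSpace E] in
lemma measure_pi_succ_eq_lintegral (ν : Measure E) [IsProbabilityMeasure ν] {n : ℕ}
    {A : Set (Fin (n + 1) → E)} (hA : MeasurableSet A) :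
    Measure.pi (fun _ : Fin (n + 1) ↦ ν) A =
      ∫⁻ y, Measure.pi (fun _ : Fin n ↦ ν) {x | (Fin.cons y x : Fin (n + 1) → E) ∈ A} ∂ν := by
  have h := (measurePreserving_piFinSuccAbove (fun _ : Fin (n + 1) ↦ ν) 0).symm
  rw [← h.measure_preimage hA.nullMeasurableSet, Measure.prod_apply (h.measurable hA)]
  refine lintegral_congr fun y ↦ ?_
  congr 1
  ext x
  simp [Fin.insertNthEquiv]

/-- Iterated **Ottaviani inequality** for random walks: if all partial sums are small with
probability at least `3 / 4`, then the number of large moves has a geometric tail. -/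
lemma measure_pi_lt_jumpCount_le (ν : Measure E) [IsProbabilityMeasure ν] {a : ℝ}
    {n : ℕ} (hν : ∀ k ≤ n, Measure.pi (fun _ : Fin k ↦ ν) {x | a < ‖∑ i, x i‖} ≤ 4⁻¹)
    (N : ℕ) (c s : E) :
    Measure.pi (fun _ : Fin n ↦ ν) {x | N < jumpCount (2 * a) c (walkFrom s (List.ofFn x))} ≤
      2 * 2⁻¹ ^ N * Measure.pi (fun _ : Fin n ↦ ν) {x | a < dist c (s + ∑ i, x i)} := by
  induction n generalizing N c s with
  | zero => simp [walkFrom, jumpCount]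
  | succ n ih =>
    specialize ih fun k hk ↦ hν k (by lia)
    have hm1 (N : ℕ) (n : ℕ) (c s : E) : MeasurableSet
        {x : Fin n → E | N < jumpCount (2 * a) c (walkFrom s (List.ofFn x))} := by
      have h : Measurable fun x : Fin n → E ↦ (c, s, x) := by fun_prop
      exact measurableSet_lt measurable_const ((measurable_jumpCount_walkFrom (2 * a) n).comp h)
    have hm2 (n : ℕ) (c s : E) : MeasurableSet {x : Fin n → E | a < dist c (s + ∑ i, x i)} :=
      measurableSet_lt measurable_const (by fun_prop)
    rw [measure_pi_succ_eq_lintegral ν (hm1 N _ c s), measure_pi_succ_eq_lintegral ν (hm2 _ c s),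
      ← lintegral_const_mul' _ _ (by finiteness)]
    refine lintegral_mono fun y ↦ ?_
    simp only [Set.mem_ofPred_eq, List.ofFn_succ, walkFrom, jumpCount, Fin.cons_zero, Fin.cons_succ,
      Fin.sum_univ_succ, ← add_assoc]
    split_ifs with h
    · have hN : Measure.pi (fun _ : Fin n ↦ ν)
          {x | N < jumpCount (2 * a) (s + y) (walkFrom (s + y) (List.ofFn x)) + 1} ≤ 2⁻¹ ^ N := by
        cases N with
        | zero => simp
        | succ N =>
          simp only [Nat.add_lt_add_iff_right]
          refine (ih N (s + y) (s + y)).trans ?_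
          simp only [dist_self_add_right]
          calc _ ≤ 2 * 2⁻¹ ^ N * (4⁻¹ : ENNReal) := by gcongr; exact hν n (by lia)
            _ = 2⁻¹ ^ (N + 1) := by
              have : (2⁻¹ : ENNReal) = 2 * 4⁻¹ := by
                rw [← ENNReal.toReal_eq_toReal_iff' (by finiteness) (by finiteness)]
                norm_num
              rw [pow_succ, mul_right_comm, ← this, mul_comm]
      refine hN.trans ?_
      have hhalf : (2⁻¹ : ENNReal) ≤ Measure.pi (fun _ : Fin n ↦ ν)
          {x | a < dist c (s + y + ∑ i, x i)} := by
        have hcompl : {x : Fin n → E | a < dist c (s + y + ∑ i, x i)}ᶜ ⊆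
            {x | a < ‖∑ i, x i‖} := by
          intro x hx
          simp only [Set.mem_compl_iff, Set.mem_ofPred_eq, not_lt] at hx ⊢
          have h1 := dist_triangle c (s + y + ∑ i, x i) (s + y)
          rw [dist_self_add_left] at h1
          linarith
        have h1 := (measure_mono hcompl).trans (hν n (by lia))
        rw [prob_compl_eq_one_sub (hm2 n c (s + y)), tsub_le_iff_right] at h1
        by_contra! h2
        have h3 : (1 : ENNReal) < 4⁻¹ + 2⁻¹ :=
          h1.trans_lt (ENNReal.add_lt_add_left (by finiteness) h2)
        rw [← ENNReal.toReal_lt_toReal (by finiteness) (by finiteness),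
          ENNReal.toReal_add (by finiteness) (by finiteness)] at h3
        norm_num at h3
      calc (2⁻¹ : ENNReal) ^ N = 2 * 2⁻¹ ^ N * 2⁻¹ := by
            rw [mul_right_comm, ENNReal.mul_inv_cancel (by simp) (by simp), one_mul]
        _ ≤ _ := by gcongr
    · exact ih N c (s + y)

end Ottaviani

section ProjectiveSequence

/-- A sequence of probability measures, each of which is the image of the next one under a
measurable map, is realized by a sequence of random variables. -/
lemma exists_measure_of_map_succ_eq {S : Type} [MeasurableSpace S] [StandardBorelSpace S]
    [Nonempty S] (R : ℕ → Measure S) [∀ m, IsProbabilityMeasure (R m)] {c : S → S}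
    (hc : Measurable c) (hR : ∀ m, (R (m + 1)).map c = R m) :
    ∃ (Ω : Type v) (_ : MeasurableSpace Ω) (Q : Measure Ω) (_ : IsProbabilityMeasure Q)
      (Z : ℕ → Ω → S), (∀ m, Measurable (Z m)) ∧ (∀ m, Q.map (Z m) = R m) ∧
        ∀ᵐ ω ∂Q, ∀ m, Z m ω = c (Z (m + 1) ω) := by
  let κ (n : ℕ) : Kernel ((i : Finset.Iic n) → S) S :=
    (condDistrib id c (R (n + 1))).comap (fun x ↦ x ⟨n, by simp⟩) (by fun_prop)
  let T : Measure (ℕ → S) := Kernel.trajMeasure (X := fun _ ↦ S) (R 0) κ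
  have hκ (n : ℕ) (hn : T.map (fun x ↦ x n) = R n) :
      T.map (fun x ↦ (x n, x (n + 1))) = (R (n + 1)).map fun x ↦ (c x, x) := by
    have h1 := Kernel.map_frestrictLe_trajMeasure_compProd_eq_map_trajMeasure
      (X := fun _ ↦ S) (μ₀ := R 0) (κ := κ) (a := n)
    have h2 := congrArg (Measure.map fun p ↦ (p.1 ⟨n, by simp⟩, p.2)) h1
    rw [Measure.map_map (by fun_prop) (by fun_prop)] at h2
    have h3 := compProd_map_condDistrib (μ := R (n + 1)) (X := c) (Y := id) aemeasurable_id
      (mβ := inferInstance)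
    rw [hR] at h3
    refine Eq.trans (Eq.trans h2.symm ?_) h3
    ext A hA
    rw [Measure.map_apply (by fun_prop) hA, Measure.compProd_apply (by measurability),
      Measure.compProd_apply hA, ← hn, lintegral_map, lintegral_map]
    · rfl
    · exact Kernel.measurable_kernel_prodMk_left hA
    · fun_prop
    · exact Kernel.measurable_kernel_prodMk_left (by measurability)
    · fun_prop
  have hlaw (n : ℕ) : T.map (fun x ↦ x n) = R n := by
    induction n with
    | zero =>
      have h : T.map (Preorder.frestrictLe (π := fun _ ↦ S) 0) =
          (R 0).map (MeasurableEquiv.piUnique fun _ : Finset.Iic 0 ↦ S).symm := by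
        simp only [T, Kernel.trajMeasure]
        rw [Measure.map_comp _ _ (by fun_prop), Kernel.traj_map_frestrictLe,
          Kernel.partialTraj_self, Measure.id_comp]
      have h2 := congrArg (Measure.map fun x ↦ x ⟨0, by simp⟩) h
      rw [Measure.map_map (by fun_prop) (by fun_prop),
        Measure.map_map (by fun_prop) (by fun_prop)] at h2
      exact h2.trans Measure.map_id
    | succ n ih =>
      have h := congrArg (Measure.map Prod.snd) (hκ n ih)
      rw [Measure.map_map (by fun_prop) (by fun_prop),
        Measure.map_map (by fun_prop) (by fun_prop)] at h
      exact h.trans Measure.map_id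
  refine ⟨ULift.{v} (ℕ → S), inferInstance, T.map ULift.up,
    Measure.isProbabilityMeasure_map measurable_up.aemeasurable, fun m ω ↦ ω.down m,
    fun m ↦ (measurable_pi_apply m).comp measurable_down, fun m ↦ ?_, ?_⟩
  · exact (Measure.map_map ((measurable_pi_apply m).comp measurable_down) measurable_up).trans
      (hlaw m)
  · rw [ae_all_iff]
    intro m
    have hA : MeasurableSet {p : S × S | p.1 = c p.2} :=
      measurableSet_eq_fun (by fun_prop) (by fun_prop)
    have h : ∀ᵐ p ∂(R (m + 1)).map (fun x ↦ (c x, x)), p.1 = c p.2 :=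
      (ae_map_iff (by fun_prop) hA).2 (.of_forall fun _ ↦ rfl)
    rw [← hκ m (hlaw m), ae_map_iff (by fun_prop) hA] at h
    refine (ae_map_iff measurable_up.aemeasurable ?_).2 h
    exact measurableSet_eq_fun ((measurable_pi_apply m).comp measurable_down)
      (hc.comp ((measurable_pi_apply (m + 1)).comp measurable_down))

end ProjectiveSequence

section Regularization

variable {E : Type*}

/-- Consistent values at the dyadic levels define a path. -/
lemma exists_path_of_dyadic {s : ℕ → ℕ → E} (hs : ∀ m i, s m i = s (m + 1) (2 * i)) :
    ∃ x : ℝ≥0 → E, ∀ m i : ℕ, x (i / 2 ^ m) = s m i := by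
  have hshift (m j i : ℕ) : s m i = s (m + j) (2 ^ j * i) := by
    induction j with
    | zero => simp
    | succ j ih => rw [ih, hs, ← add_assoc, pow_succ', mul_assoc]
  have h (m n i j : ℕ) (hij : (i / 2 ^ m : ℝ≥0) = j / 2 ^ n) : s m i = s n j := by
    rw [hshift m n i, hshift n m j, add_comm n m]
    congr 1
    rw [div_eq_div_iff (by positivity) (by positivity)] at hij
    have : i * 2 ^ n = j * 2 ^ m := by exact_mod_cast hij
    linarith
  classical
  refine ⟨fun q ↦ if hq : ∃ p : ℕ × ℕ, (p.2 / 2 ^ p.1 : ℝ≥0) = q then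
    s hq.choose.1 hq.choose.2 else s 0 0, fun m i ↦ ?_⟩
  have hq : ∃ p : ℕ × ℕ, (p.2 / 2 ^ p.1 : ℝ≥0) = i / 2 ^ m := ⟨(m, i), rfl⟩
  refine (dif_pos hq).trans ?_
  exact h _ _ _ _ hq.choose_spec

lemma Dense.neBot_nhdsWithin_inter_Ioi {D : Set ℝ≥0} (hD : Dense D) (t : ℝ≥0) :
    (𝓝[D ∩ Set.Ioi t] t).NeBot := by
  rw [← mem_closure_iff_nhdsWithin_neBot, Set.inter_comm]
  refine closure_minimal (hD.open_subset_closure_inter isOpen_Ioi) isClosed_closure ?_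
  rw [closure_Ioi]
  exact Set.self_mem_Ici

/-- A function on the nonnegative reals restricted to a set `D` having one-sided limits everywhere
has a càdlàg right limit. -/
lemma exists_isCadlagPath_of_tendsto [TopologicalSpace E] [T3Space E] {D : Set ℝ≥0}
    (hD : Dense D) {x : ℝ≥0 → E}
    (hr : ∀ t, ∃ l, Tendsto x (𝓝[D ∩ Set.Ioi t] t) (𝓝 l))
    (hl : ∀ t, ∃ l, Tendsto x (𝓝[D ∩ Set.Iio t] t) (𝓝 l)) :
    ∃ y : ℝ≥0 → E, IsCadlagPath y ∧ ∀ t, Tendsto x (𝓝[D ∩ Set.Ioi t] t) (𝓝 (y t)) := by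
  choose y hy using hr
  have hne (t : ℝ≥0) : (𝓝[D ∩ Set.Ioi t] t).NeBot := hD.neBot_nhdsWithin_inter_Ioi t
  have key (t : ℝ≥0) (K : Set E) (hK : IsClosed K) (U : Set ℝ≥0) (hU : IsOpen U) (ht : t ∈ U)
      (h : ∀ q ∈ D ∩ U, t < q → x q ∈ K) : y t ∈ K := by
    refine hK.mem_of_tendsto (hy t) ?_
    filter_upwards [self_mem_nhdsWithin, mem_nhdsWithin_of_mem_nhds (hU.mem_nhds ht)] with q hq hqU
    exact h q ⟨hq.1, hqU⟩ hq.2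
  refine ⟨y, fun t ↦ ⟨?_, ?_⟩, hy⟩
  · rw [ContinuousWithinAt, (closed_nhds_basis (y t)).tendsto_right_iff]
    rintro K ⟨hK, hKc⟩
    obtain ⟨U, hU, htU, hUK⟩ := mem_nhdsWithin.1 (hy t hK)
    filter_upwards [self_mem_nhdsWithin, mem_nhdsWithin_of_mem_nhds (hU.mem_nhds htU)] with r hr hrU
    exact key r K hKc U hU hrU fun q hq hrq ↦ hUK ⟨hq.2, hq.1, lt_of_le_of_lt hr hrq⟩
  · obtain ⟨l, hl⟩ := hl t
    refine ⟨l, ?_⟩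
    rw [(closed_nhds_basis l).tendsto_right_iff]
    rintro K ⟨hK, hKc⟩
    obtain ⟨U, hU, htU, hUK⟩ := mem_nhdsWithin.1 (hl hK)
    filter_upwards [self_mem_nhdsWithin, mem_nhdsWithin_of_mem_nhds (hU.mem_nhds htU)] with r hr hrU
    exact key r K hKc (U ∩ Set.Iio t) (hU.inter isOpen_Iio) ⟨hrU, hr⟩
      fun q hq _ ↦ hUK ⟨hq.2.1, hq.1, hq.2.2⟩

/-- If a function oscillates by more than `ε` in every neighborhood, relative to `D`, to the right
of `t`, it has arbitrarily long chains of moves greater than `ε / 2`. -/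
lemma exists_chain_right [PseudoMetricSpace E] {D : Set ℝ≥0} {x : ℝ≥0 → E} {t b : ℝ≥0} {ε : ℝ}
    (hb : t < b)
    (h : ∀ b > t, ∃ q ∈ D ∩ Set.Ioo t b, ∃ r ∈ D ∩ Set.Ioo t b, 2 * ε < dist (x q) (x r))
    (n : ℕ) : ∃ l : List ℝ≥0, l.length = n ∧ (∀ q ∈ l, q ∈ D ∩ Set.Ioo t b) ∧
      l.IsChain fun q r ↦ q < r ∧ ε < dist (x q) (x r) := by
  suffices H : ∃ p l, (p :: l).length = n + 1 ∧ (∀ q ∈ p :: l, q ∈ D ∩ Set.Ioo t b) ∧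
      (p :: l).IsChain fun q r ↦ q < r ∧ ε < dist (x q) (x r) by
    obtain ⟨p, l, h1, h2, h3⟩ := H
    exact ⟨l, by simpa using h1, fun q hq ↦ h2 q (List.mem_cons_of_mem _ hq), h3.of_cons⟩
  induction n with
  | zero =>
    obtain ⟨q, hq, -⟩ := h b hb
    exact ⟨q, [], by simp, by simpa using hq, by simp⟩
  | succ n ih =>
    obtain ⟨p, l, h1, h2, h3⟩ := ih
    obtain ⟨q, hq, r, hr, hqr⟩ := h p (h2 p (by simp)).2.1
    have hpb := (h2 p (by simp)).2.2
    have : ∃ z ∈ D ∩ Set.Ioo t p, ε < dist (x z) (x p) := by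
      by_contra! hcon
      have := hcon q hq
      have := hcon r hr
      have := dist_triangle_right (x q) (x r) (x p)
      linarith
    obtain ⟨z, hz, hzp⟩ := this
    refine ⟨z, p :: l, by simpa using h1, ?_, ?_⟩
    · intro w hw
      rcases List.mem_cons.1 hw with rfl | hw
      · exact ⟨hz.1, hz.2.1, hz.2.2.trans hpb⟩
      · exact h2 w hw
    · exact List.isChain_cons_cons.2 ⟨⟨hz.2.2, hzp⟩, h3⟩

lemma exists_chain_left [PseudoMetricSpace E] {D : Set ℝ≥0} {x : ℝ≥0 → E} {t b : ℝ≥0} {ε : ℝ}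
    (hb : b < t)
    (h : ∀ b < t, ∃ q ∈ D ∩ Set.Ioo b t, ∃ r ∈ D ∩ Set.Ioo b t, 2 * ε < dist (x q) (x r))
    (n : ℕ) : ∃ l : List ℝ≥0, l.length = n ∧ (∀ q ∈ l, q ∈ D ∩ Set.Ioo b t) ∧
      l.IsChain fun q r ↦ q < r ∧ ε < dist (x q) (x r) := by
  suffices H : ∃ p l, (p :: l).length = n + 1 ∧ (∀ q ∈ p :: l, q ∈ D ∩ Set.Ioo b t) ∧
      (p :: l).IsChain fun q r ↦ r < q ∧ ε < dist (x r) (x q) by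
    obtain ⟨p, l, h1, h2, h3⟩ := H
    refine ⟨l.reverse, by simpa using h1, fun q hq ↦ h2 q ?_, ?_⟩
    · exact List.mem_cons_of_mem _ (by simpa using hq)
    · exact List.isChain_reverse.2 h3.of_cons
  induction n with
  | zero =>
    obtain ⟨q, hq, -⟩ := h b hb
    exact ⟨q, [], by simp, by simpa using hq, by simp⟩
  | succ n ih =>
    obtain ⟨p, l, h1, h2, h3⟩ := ih
    obtain ⟨q, hq, r, hr, hqr⟩ := h p (h2 p (by simp)).2.2
    have hpb := (h2 p (by simp)).2.1
    have : ∃ z ∈ D ∩ Set.Ioo p t, ε < dist (x z) (x p) := by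
      by_contra! hcon
      have := hcon q hq
      have := hcon r hr
      have := dist_triangle_right (x q) (x r) (x p)
      linarith
    obtain ⟨z, hz, hzp⟩ := this
    refine ⟨z, p :: l, by simpa using h1, ?_, ?_⟩
    · intro w hw
      rcases List.mem_cons.1 hw with rfl | hw
      · exact ⟨hz.1, hpb.trans hz.2.1, hz.2.2⟩
      · exact h2 w hw
    · exact List.isChain_cons_cons.2 ⟨⟨hz.2.1, by rwa [dist_comm]⟩, h3⟩

lemma exists_forall_mem_eq_div_two_pow (l : List ℝ≥0)
    (hl : ∀ q ∈ l, ∃ m i : ℕ, q = i / 2 ^ m) (r : ℕ) :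
    ∃ m, ∃ l' : List ℕ, l = l'.map fun i : ℕ ↦ (i / 2 ^ (r + m) : ℝ≥0) := by
  have lift (q : ℝ≥0) (m n : ℕ) (h : ∃ i : ℕ, q = i / 2 ^ m) : ∃ i : ℕ, q = i / 2 ^ (m + n) := by
    obtain ⟨i, rfl⟩ := h
    refine ⟨i * 2 ^ n, ?_⟩
    push_cast
    rw [pow_add, mul_div_mul_right _ _ (by positivity)]
  suffices H : ∃ m, ∀ q ∈ l, ∃ i : ℕ, q = i / 2 ^ m by
    obtain ⟨m, hm⟩ := H
    refine ⟨m, ?_⟩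
    have h : ∀ q ∈ l, ∃ i : ℕ, (i / 2 ^ (r + m) : ℝ≥0) = q := fun q hq ↦ by
      obtain ⟨i, hi⟩ := lift q m r (hm q hq)
      exact ⟨i, by rw [hi, add_comm]⟩
    clear hl hm
    induction l with
    | nil => exact ⟨[], rfl⟩
    | cons q l ih =>
      obtain ⟨l', hl'⟩ := ih fun q hq ↦ h q (List.mem_cons_of_mem _ hq)
      obtain ⟨i, hi⟩ := h q (by simp)
      exact ⟨i :: l', by simp [← hl', hi]⟩
  induction l with
  | nil => exact ⟨0, by simp⟩
  | cons q l ih =>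
    obtain ⟨m, hm⟩ := ih fun q hq ↦ hl q (List.mem_cons_of_mem _ hq)
    obtain ⟨n, hn⟩ := hl q (by simp)
    refine ⟨m + n, fun z hz ↦ ?_⟩
    rcases List.mem_cons.1 hz with rfl | hz
    · rw [add_comm]; exact lift _ n m hn
    · exact lift z m n (hm z hz)

lemma dense_range_div_two_pow : Dense {q : ℝ≥0 | ∃ m i : ℕ, q = i / 2 ^ m} := by
  refine dense_of_exists_between fun a b hab ↦ ?_
  obtain ⟨m, hm⟩ := exists_pow_lt_of_lt_one (tsub_pos_of_lt hab) (by norm_num : (2⁻¹ : ℝ≥0) < 1)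
  have h1 := Nat.lt_floor_add_one (a * 2 ^ m)
  have h2 := Nat.floor_le (zero_le : 0 ≤ a * 2 ^ m)
  refine ⟨_, ⟨m, ⌊a * 2 ^ m⌋₊ + 1, rfl⟩, ?_, ?_⟩
  · rw [lt_div_iff₀ (by positivity)]
    exact_mod_cast h1
  · rw [lt_tsub_iff_left] at hm
    refine lt_of_le_of_lt ?_ hm
    rw [div_le_iff₀ (by positivity), add_mul, inv_pow, inv_mul_cancel₀ (by positivity)]
    push_cast
    gcongr

lemma tendsto_floor_add_one_div_two_pow (t : ℝ≥0) :
    Tendsto (fun m : ℕ ↦ ((⌊t * 2 ^ m⌋₊ + 1 : ℕ) / 2 ^ m : ℝ≥0)) atTop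
      (𝓝[{q | ∃ m i : ℕ, q = i / 2 ^ m} ∩ Set.Ioi t] t) := by
  have hgt (m : ℕ) : t < (⌊t * 2 ^ m⌋₊ + 1 : ℕ) / 2 ^ m := by
    rw [lt_div_iff₀ (by positivity)]
    exact_mod_cast Nat.lt_floor_add_one (t * 2 ^ m)
  refine tendsto_nhdsWithin_iff.2 ⟨?_, .of_forall fun m ↦ ⟨⟨m, _, rfl⟩, hgt m⟩⟩
  refine tendsto_of_tendsto_of_tendsto_of_le_of_le (h := fun m ↦ t + 2⁻¹ ^ m) tendsto_const_nhds ?_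
    (fun m ↦ (hgt m).le) fun m ↦ ?_
  · nth_rw 2 [← add_zero t]
    exact (NNReal.tendsto_pow_atTop_nhds_zero_of_lt_one (by norm_num)).const_add t
  · simp only
    rw [div_le_iff₀ (by positivity), add_mul, inv_pow, inv_mul_cancel₀ (by positivity)]
    push_cast
    gcongr
    exact Nat.floor_le zero_le

/-- A path given consistently on the dyadic numbers, whose restriction to dyadic intervals of small
enough length has chains of large moves of bounded length only, has a càdlàg right limit. -/
lemma exists_isCadlagPath_of_chain_length_le [MetricSpace E] [CompleteSpace E] {s : ℕ → ℕ → E}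
    (hs : ∀ m i, s m i = s (m + 1) (2 * i))
    (hosc : ∀ ε > 0, ∃ r : ℕ, ∀ k : ℕ, ∃ N : ℕ, ∀ m, ∀ l : List ℕ,
      (∀ i ∈ l, k * 2 ^ m < i ∧ i ≤ (k + 1) * 2 ^ m) →
      (l.IsChain fun i j ↦ i < j ∧ ε < dist (s (r + m) i) (s (r + m) j)) → l.length ≤ N) :
    ∃ y : ℝ≥0 → E, IsCadlagPath y ∧
      ∀ t : ℝ≥0, Tendsto (fun m ↦ s m (⌊t * 2 ^ m⌋₊ + 1)) atTop (𝓝 (y t)) := by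
  obtain ⟨x, hx⟩ := exists_path_of_dyadic hs
  set D : Set ℝ≥0 := {q | ∃ m i : ℕ, q = i / 2 ^ m}
  have hD : Dense D := dense_range_div_two_pow
  have hosc' : ∀ ε > 0, ∃ r : ℕ, ∀ k : ℕ, ∃ N : ℕ, ∀ l : List ℝ≥0,
      (∀ q ∈ l, q ∈ D ∩ Set.Ioc (k / 2 ^ r : ℝ≥0) ((k + 1 : ℕ) / 2 ^ r)) →
      (l.IsChain fun q p ↦ q < p ∧ ε < dist (x q) (x p)) → l.length ≤ N := by
    intro ε hε
    obtain ⟨r, hr⟩ := hosc ε hε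
    refine ⟨r, fun k ↦ ?_⟩
    obtain ⟨N, hN⟩ := hr k
    refine ⟨N, fun l hl hc ↦ ?_⟩
    obtain ⟨m, l', rfl⟩ := exists_forall_mem_eq_div_two_pow l (fun q hq ↦ (hl q hq).1) r
    rw [List.length_map]
    refine hN m l' (fun i hi ↦ ?_) ?_
    · have h := (hl _ (List.mem_map_of_mem hi)).2
      rw [Set.mem_Ioc, pow_add, ← div_div, div_right_comm, div_lt_div_iff_of_pos_right (by positivity),
        div_le_div_iff_of_pos_right (by positivity), lt_div_iff₀ (by positivity),
        div_le_iff₀ (by positivity)] at h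
      exact_mod_cast h
    · rw [List.isChain_map] at hc
      refine hc.imp fun i j hij ↦ ?_
      rw [hx, hx, div_lt_div_iff_of_pos_right (by positivity)] at hij
      exact_mod_cast hij
  have hneL (t : ℝ≥0) (ht : 0 < t) : (𝓝[D ∩ Set.Iio t] t).NeBot := by
    rw [← mem_closure_iff_nhdsWithin_neBot, Set.inter_comm]
    refine closure_minimal (hD.open_subset_closure_inter isOpen_Iio) isClosed_closure ?_
    rw [closure_Iio' (a := t) ⟨0, ht⟩]
    exact Set.self_mem_Iic
  have hr (t : ℝ≥0) : ∃ l, Tendsto x (𝓝[D ∩ Set.Ioi t] t) (𝓝 l) := by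
    have := hD.neBot_nhdsWithin_inter_Ioi t
    refine CompleteSpace.complete (Metric.cauchy_iff.2 ⟨inferInstance, fun ε hε ↦ ?_⟩)
    obtain ⟨r, hr⟩ := hosc' (ε / 2 / 2) (by positivity)
    obtain ⟨N, hN⟩ := hr ⌊t * 2 ^ r⌋₊
    by_contra! hcon
    have hb : t < (⌊t * 2 ^ r⌋₊ + 1 : ℕ) / 2 ^ r := by
      rw [lt_div_iff₀ (by positivity)]
      exact_mod_cast Nat.lt_floor_add_one (t * 2 ^ r)
    have ha : (⌊t * 2 ^ r⌋₊ / 2 ^ r : ℝ≥0) ≤ t := by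
      rw [div_le_iff₀ (by positivity)]
      exact Nat.floor_le zero_le
    obtain ⟨l, h1, h2, h3⟩ := exists_chain_right (D := D) (x := x) (ε := ε / 2 / 2) hb
      (fun b hb ↦ by
        have hmem : x '' (D ∩ Set.Ioo t b) ∈ map x (𝓝[D ∩ Set.Ioi t] t) := by
          refine image_mem_map ?_
          filter_upwards [self_mem_nhdsWithin, mem_nhdsWithin_of_mem_nhds (Iio_mem_nhds hb)]
            with q hq hqb using ⟨hq.1, hq.2, hqb⟩
        obtain ⟨_, ⟨q, hq, rfl⟩, _, ⟨p, hp, rfl⟩, h⟩ := hcon _ hmem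
        exact ⟨q, hq, p, hp, by linarith⟩) (N + 1)
    have := hN l (fun q hq ↦ ⟨(h2 q hq).1, ha.trans_lt (h2 q hq).2.1, (h2 q hq).2.2.le⟩) h3
    lia
  have hl (t : ℝ≥0) : ∃ l, Tendsto x (𝓝[D ∩ Set.Iio t] t) (𝓝 l) := by
    obtain rfl | ht := eq_zero_or_pos t
    · exact ⟨x 0, by simp⟩
    have := hneL t ht
    refine CompleteSpace.complete (Metric.cauchy_iff.2 ⟨inferInstance, fun ε hε ↦ ?_⟩)
    obtain ⟨r, hr⟩ := hosc' (ε / 2 / 2) (by positivity)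
    have hpos : 0 < t * 2 ^ r := by positivity
    obtain ⟨k, hk⟩ := Nat.exists_eq_succ_of_ne_zero (Nat.ceil_pos.2 hpos).ne'
    obtain ⟨N, hN⟩ := hr k
    by_contra! hcon
    have hb : t ≤ (k + 1 : ℕ) / 2 ^ r := by
      rw [le_div_iff₀ (by positivity)]
      exact Nat.ceil_le.1 hk.le
    have ha : (k / 2 ^ r : ℝ≥0) < t := by
      rw [div_lt_iff₀ (by positivity)]
      exact Nat.lt_ceil.1 (by lia)
    obtain ⟨l, h1, h2, h3⟩ := exists_chain_left (D := D) (x := x) (ε := ε / 2 / 2) ha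
      (fun b hb ↦ by
        have hmem : x '' (D ∩ Set.Ioo b t) ∈ map x (𝓝[D ∩ Set.Iio t] t) := by
          refine image_mem_map ?_
          filter_upwards [self_mem_nhdsWithin, mem_nhdsWithin_of_mem_nhds (Ioi_mem_nhds hb)]
            with q hq hqb using ⟨hq.1, hqb, hq.2⟩
        obtain ⟨_, ⟨q, hq, rfl⟩, _, ⟨p, hp, rfl⟩, h⟩ := hcon _ hmem
        exact ⟨q, hq, p, hp, by linarith⟩) (N + 1)
    have := hN l (fun q hq ↦ ⟨(h2 q hq).1, (h2 q hq).2.1, (h2 q hq).2.2.le.trans hb⟩) h3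
    lia
  obtain ⟨y, hy, hyx⟩ := exists_isCadlagPath_of_tendsto hD hr hl
  refine ⟨y, hy, fun t ↦ ?_⟩
  have h := (hyx t).comp (tendsto_floor_add_one_div_two_pow t)
  refine h.congr fun m ↦ ?_
  exact hx _ _

end Regularization

section Independence

variable {Ω ι : Type*} [MeasurableSpace Ω] {P : Measure Ω}

/-- Grouping independent random variables into disjoint blocks yields independent blocks. -/
lemma iIndepFun_curry {κ : ι → Type*} {𝓧 : (i : ι) → κ i → Type*}
    [∀ i j, MeasurableSpace (𝓧 i j)] {X : (p : (i : ι) × κ i) → Ω → 𝓧 p.1 p.2}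
    (mX : ∀ p, Measurable (X p)) (h : iIndepFun X P) :
    iIndepFun (fun i ω (j : κ i) ↦ X ⟨i, j⟩ ω) P := by
  have := h.isProbabilityMeasure
  have (i : ι) (j : κ i) : IsProbabilityMeasure (P.map (X ⟨i, j⟩)) :=
    Measure.isProbabilityMeasure_map (mX _).aemeasurable
  have h1 := congrArg (Measure.map (MeasurableEquiv.piCurry 𝓧)) (h.map_fun_eq_infinitePi_map mX)
  rw [Measure.infinitePi_map_piCurry fun i j ↦ P.map (X ⟨i, j⟩),
    Measure.map_map (by fun_prop) (by fun_prop)] at h1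
  rw [iIndepFun_iff_map_fun_eq_infinitePi_map (by fun_prop)]
  refine h1.trans ?_
  congr 1
  ext1 i
  exact ((h.precomp (g := fun j : κ i ↦ ⟨i, j⟩) sigma_mk_injective).map_fun_eq_infinitePi_map
    fun j ↦ mX _).symm

variable {E : Type*} [MeasurableSpace E] {κ : Type*}

/-- Sums of independent random variables over disjoint index sets are independent. -/
lemma iIndepFun.finsetSum [AddCommMonoid E] [MeasurableAdd₂ E] {ξ : κ → Ω → E}
    (mξ : ∀ k, Measurable (ξ k)) (h : iIndepFun ξ P) {s : ι → Finset κ}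
    (hs : Pairwise fun i j ↦ Disjoint (s i) (s j)) :
    iIndepFun (fun i ω ↦ ∑ k ∈ s i, ξ k ω) P := by
  have hinj : Function.Injective fun p : (i : ι) × s i ↦ (p.2 : κ) := by
    rintro ⟨i, k, hk⟩ ⟨j, l, hl⟩ (rfl : k = l)
    obtain rfl : i = j := by
      by_contra hij
      exact Finset.disjoint_left.1 (hs hij) hk hl
    rfl
  have h1 := iIndepFun_curry (𝓧 := fun i (_ : s i) ↦ E)
    (X := fun (p : (i : ι) × s i) ↦ ξ p.2) (fun p ↦ mξ _)
    (iIndepFun.precomp (f := ξ) hinj h)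
  have h2 := h1.comp (fun i (x : s i → E) ↦ ∑ k, x k) (fun i ↦ by fun_prop)
  refine iIndepFun.congr (fun i ↦ .of_forall fun ω ↦ ?_) h2
  exact Finset.sum_coe_sort (s i) fun k ↦ ξ k ω

end Independence

section Limits

variable {Ω ι : Type*} [MeasurableSpace Ω] {P : Measure Ω} [IsProbabilityMeasure P]
  {E : Type*} [NormedAddCommGroup E] [InnerProductSpace ℝ E] [MeasurableSpace E] [BorelSpace E]

lemma tendsto_charFun_of_tendstoInDistribution {l : Filter ι} {X : ι → Ω → E} {Z : Ω → E}
    (h : TendstoInDistribution X l Z (fun _ ↦ P) P) (u : E) :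
    Tendsto (fun i ↦ charFun (P.map (X i)) u) l (𝓝 (charFun (P.map Z) u)) := by
  have h1 := h.tendsto
  have h2 := (ProbabilityMeasure.tendsto_iff_forall_integral_rclike_tendsto ℂ).1 h1
  simp_rw [charFun_eq_integral_innerProbChar]
  exact h2 (BoundedContinuousFunction.innerProbChar u)

lemma tendsto_charFun_of_ae_tendsto {l : Filter ι} [l.IsCountablyGenerated] {X : ι → Ω → E}
    {Z : Ω → E} (hX : ∀ i, Measurable (X i)) (hZ : Measurable Z)
    (h : ∀ᵐ ω ∂P, Tendsto (fun i ↦ X i ω) l (𝓝 (Z ω))) (u : E) :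
    Tendsto (fun i ↦ charFun (P.map (X i)) u) l (𝓝 (charFun (P.map Z) u)) :=
  tendsto_charFun_of_tendstoInDistribution
    (tendstoInDistribution_of_ae_tendsto (fun i ↦ (hX i).aemeasurable) hZ.aemeasurable h) u

/-- Independence of finitely many random vectors is preserved by almost sure limits. -/
lemma iIndepFun_of_ae_tendsto [CompleteSpace E] [SecondCountableTopology E] [Fintype ι]
    {V : ℕ → ι → Ω → E} {W : ι → Ω → E} (hV : ∀ m i, Measurable (V m i))
    (hW : ∀ i, Measurable (W i)) (hindep : ∀ m, iIndepFun (V m) P)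
    (h : ∀ᵐ ω ∂P, ∀ i, Tendsto (fun m ↦ V m i ω) atTop (𝓝 (W i ω))) : iIndepFun W P := by
  rw [iIndepFun_iff_charFun_pi fun i ↦ (hW i).aemeasurable]
  intro u
  have h1 : Tendsto (fun m ↦ charFun (P.map fun ω ↦ WithLp.toLp 2 fun i ↦ V m i ω) u) atTop
      (𝓝 (charFun (P.map fun ω ↦ WithLp.toLp 2 fun i ↦ W i ω) u)) := by
    refine tendsto_charFun_of_ae_tendsto (fun m ↦ by fun_prop) (by fun_prop) ?_ u
    filter_upwards [h] with ω hω
    exact (PiLp.continuous_toLp 2 fun _ : ι ↦ E).continuousAt.tendsto.comp (tendsto_pi_nhds.2 hω)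
  have h2 : Tendsto (fun m ↦ ∏ i, charFun (P.map (V m i)) (u i)) atTop
      (𝓝 (∏ i, charFun (P.map (W i)) (u i))) := by
    refine tendsto_finsetProd _ fun i _ ↦
      tendsto_charFun_of_ae_tendsto (fun m ↦ hV m i) (hW i) ?_ _
    filter_upwards [h] with ω hω using hω i
  refine tendsto_nhds_unique h1 (h2.congr fun m ↦ ?_)
  exact ((iIndepFun_iff_charFun_pi fun i ↦ (hV m i).aemeasurable).1 (hindep m) u).symm

omit [IsProbabilityMeasure P] in
lemma charFun_map_finsetSum_eq_pow [SecondCountableTopology E] {κ : Type*} {ξ : κ → Ω → E}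
    (mξ : ∀ k, Measurable (ξ k)) (hξ : iIndepFun ξ P) {ν : Measure E}
    (hν : ∀ k, P.map (ξ k) = ν) (s : Finset κ) :
    charFun (P.map fun ω ↦ ∑ k ∈ s, ξ k ω) = charFun ν ^ s.card := by
  rw [iIndepFun.charFun_map_fun_finsetSum_eq_prod (fun k _ ↦ (mξ k).aemeasurable)
    (iIndepFun.precomp (f := ξ) Subtype.val_injective hξ)]
  simp [hν]

end Limits

section Semigroup

variable {E : Type*} [NormedAddCommGroup E] [InnerProductSpace ℝ E] [MeasurableSpace E]
  [BorelSpace E] [SecondCountableTopology E]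

lemma charFun_eq_one_of_sq_eq [CompleteSpace E] (μ : Measure E) [IsProbabilityMeasure μ]
    (h : ∀ u, charFun μ u ^ 2 = charFun μ u) : charFun μ = 1 := by
  have hcont : Continuous (charFun μ) := continuous_charFun
  have h01 (u : E) : charFun μ u ∈ ({0, 1} : Set ℂ) := by
    have h2 : charFun μ u * (charFun μ u - 1) = 0 := by linear_combination h u
    rcases mul_eq_zero.1 h2 with h3 | h3
    · simp [h3]
    · simp [sub_eq_zero.1 h3]
  funext u
  have hfin : ({0, 1} : Set ℂ).Finite := by simp
  have := isPreconnected_univ.constant_of_mapsTo (T := ({0, 1} : Set ℂ)) hfin.isDiscrete hcont.continuousOn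
    (fun u _ ↦ h01 u) (Set.mem_univ u) (Set.mem_univ (0 : E))
  simpa using this

lemma ae_eq_zero_of_charFun_map_eq_one [CompleteSpace E] {Ω : Type*} [MeasurableSpace Ω]
    {P : Measure Ω} [IsProbabilityMeasure P] {Z : Ω → E} (hZ : Measurable Z)
    (h : charFun (P.map Z) = 1) : ∀ᵐ ω ∂P, Z ω = 0 := by
  have := Measure.isProbabilityMeasure_map (μ := P) hZ.aemeasurable
  have hdirac : P.map Z = Measure.dirac 0 := by
    refine Measure.ext_of_charFun ?_
    rw [h]
    ext u
    simp
  refine ae_of_ae_map (p := (· = 0)) hZ.aemeasurable ?_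
  rw [hdirac]
  exact (ae_dirac_iff (measurableSet_singleton 0)).2 rfl

variable {μ : ℝ≥0 → Measure E} [∀ t, IsProbabilityMeasure (μ t)]

lemma charFun_zero_eq_one_of_conv [CompleteSpace E] (hconv : ∀ s t, μ (s + t) = μ s ∗ μ t) :
    charFun (μ 0) = 1 := by
  refine charFun_eq_one_of_sq_eq _ fun u ↦ ?_
  nth_rw 2 [← add_zero 0]
  rw [hconv, charFun_conv, sq]

lemma charFun_nat_mul_of_conv [CompleteSpace E] (hconv : ∀ s t, μ (s + t) = μ s ∗ μ t) (n : ℕ)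
    (t : ℝ≥0) : charFun (μ (n * t)) = charFun (μ t) ^ n := by
  induction n with
  | zero => simp [charFun_zero_eq_one_of_conv hconv]
  | succ n ih =>
    ext u
    rw [Nat.cast_succ, add_mul, one_mul, hconv, charFun_conv, ih, pow_succ]
    rfl

/-- A convolution semigroup is realized, along the dyadic partitions of the half-line, by
independent and identically distributed increments that are consistent across all levels. -/
lemma exists_dyadic_increments {E : Type} [NormedAddCommGroup E] [InnerProductSpace ℝ E]
    [CompleteSpace E] [SecondCountableTopology E] [MeasurableSpace E] [BorelSpace E]
    {μ : ℝ≥0 → Measure E} [∀ t, IsProbabilityMeasure (μ t)]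
    (hconv : ∀ s t, μ (s + t) = μ s ∗ μ t) :
    ∃ (Ω : Type v) (_ : MeasurableSpace Ω) (Q : Measure Ω) (_ : IsProbabilityMeasure Q)
      (ξ : ℕ → ℕ → Ω → E), (∀ m i, Measurable (ξ m i)) ∧ (∀ m, iIndepFun (ξ m) Q) ∧
        (∀ m i, Q.map (ξ m i) = μ (2⁻¹ ^ m)) ∧
        ∀ᵐ ω ∂Q, ∀ m i, ξ m i ω = ξ (m + 1) (2 * i) ω + ξ (m + 1) (2 * i + 1) ω := by
  let R (m : ℕ) : Measure (ℕ → E) := Measure.infinitePi fun _ ↦ μ (2⁻¹ ^ m)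
  have hindep (m : ℕ) : iIndepFun (fun i (x : ℕ → E) ↦ x i) (R m) :=
    iIndepFun_infinitePi (X := fun _ x ↦ x) fun _ ↦ by fun_prop
  have hlaw (m i : ℕ) : (R m).map (fun x ↦ x i) = μ (2⁻¹ ^ m) :=
    Measure.infinitePi_map_eval (fun _ ↦ μ (2⁻¹ ^ m)) i
  have hR (m : ℕ) : (R (m + 1)).map (fun x i ↦ x (2 * i) + x (2 * i + 1)) = R m := by
    have hsum (x : ℕ → E) (i : ℕ) : x (2 * i) + x (2 * i + 1) =
        ∑ k ∈ ({2 * i, 2 * i + 1} : Finset ℕ), x k := by rw [Finset.sum_pair (by lia)]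
    have h1 : iIndepFun (fun i (x : ℕ → E) ↦ x (2 * i) + x (2 * i + 1)) (R (m + 1)) := by
      simp_rw [hsum]
      refine iIndepFun.finsetSum (fun k ↦ by fun_prop) (hindep (m + 1)) fun i j hij ↦ ?_
      refine Finset.disjoint_left.2 fun k hk hk' ↦ ?_
      simp only [Finset.mem_insert, Finset.mem_singleton] at hk hk'
      lia
    rw [h1.map_fun_eq_infinitePi_map (fun i ↦ by fun_prop)]
    congr 1
    ext1 i
    have : IsProbabilityMeasure ((R (m + 1)).map fun x ↦ x (2 * i) + x (2 * i + 1)) :=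
      Measure.isProbabilityMeasure_map (by fun_prop)
    refine Measure.ext_of_charFun ?_
    simp_rw [hsum]
    rw [charFun_map_finsetSum_eq_pow (fun k ↦ by fun_prop) (hindep (m + 1)) (hlaw (m + 1)),
      Finset.card_pair (by lia), ← charFun_nat_mul_of_conv hconv]
    congr 2
    rw [pow_succ', Nat.cast_ofNat, mul_inv_cancel_left₀ two_ne_zero]
  obtain ⟨Ω, _, Q, hQ, Z, hZ, hZR, hZc⟩ :=
    exists_measure_of_map_succ_eq.{v} R (c := fun x i ↦ x (2 * i) + x (2 * i + 1))
      (by fun_prop) hR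
  have hZi (m i : ℕ) : Q.map (fun ω ↦ Z m ω i) = μ (2⁻¹ ^ m) := by
    rw [← hlaw m i, ← hZR m, Measure.map_map (by fun_prop) (hZ m)]
    rfl
  refine ⟨Ω, _, Q, hQ, fun m i ω ↦ Z m ω i, fun m i ↦ by fun_prop, fun m ↦ ?_, hZi, ?_⟩
  · rw [iIndepFun_iff_map_fun_eq_infinitePi_map (fun i ↦ by fun_prop)]
    simp_rw [hZi]
    exact hZR m
  · filter_upwards [hZc] with ω hω m i
    exact congrFun (hω m) i

end Semigroup

section Chains

variable {Ω : Type*} [MeasurableSpace Ω] {Q : Measure Ω} {E : Type*} [NormedAddCommGroup E]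
  [MeasurableSpace E] [BorelSpace E] [SecondCountableTopology E]

/-- The probability that a random walk has a long chain of large moves decays geometrically. -/
lemma measure_exists_chain_le {ζ : ℕ → Ω → E} (mζ : ∀ i, Measurable (ζ i)) (hζ : iIndepFun ζ Q)
    {ν : Measure E} [IsProbabilityMeasure ν] (hν : ∀ i, Q.map (ζ i) = ν) {ε : ℝ} (hε : 0 < ε)
    {n : ℕ} (htail : ∀ k ≤ n, Measure.pi (fun _ : Fin k ↦ ν) {x | ε / 4 < ‖∑ i, x i‖} ≤ 4⁻¹)
    (N : ℕ) :
    Q {ω | ∃ l : List ℕ, (∀ i ∈ l, 0 < i ∧ i ≤ n) ∧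
      (l.IsChain fun i j ↦ i < j ∧
        ε < dist (∑ k ∈ Finset.range i, ζ k ω) (∑ k ∈ Finset.range j, ζ k ω)) ∧
      N + 1 < l.length} ≤ 2 * 2⁻¹ ^ N := by
  have hlaw : Q.map (fun ω (i : Fin n) ↦ ζ i ω) = Measure.pi fun _ ↦ ν := by
    have h0 : iIndepFun (fun i : Fin n ↦ ζ i) Q := iIndepFun.precomp (f := ζ) Fin.val_injective hζ
    have h := h0.map_fun_eq_pi_map (f := fun i : Fin n ↦ ζ i) fun i ↦ (mζ i).aemeasurable
    simpa [hν] using h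
  have hm : MeasurableSet
      {x : Fin n → E | N < jumpCount (2 * (ε / 4)) 0 (walkFrom 0 (List.ofFn x))} := by
    have h : Measurable fun x : Fin n → E ↦ ((0 : E), (0 : E), x) := by fun_prop
    exact measurableSet_lt measurable_const
      ((measurable_jumpCount_walkFrom (2 * (ε / 4)) n).comp h)
  have hbound := measure_pi_lt_jumpCount_le ν htail N 0 0
  rw [← hlaw, Measure.map_apply (by fun_prop) hm] at hbound
  have hone : Measure.map (fun ω (i : Fin n) ↦ ζ i ω) Q
      {x | ε / 4 < dist 0 (0 + ∑ i, x i)} ≤ 1 := by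
    rw [hlaw]; exact prob_le_one
  refine (measure_mono ?_).trans (hbound.trans (mul_le_of_le_one_right' hone))
  rintro ω ⟨l, hl, hc, hlen⟩
  have hsub : l.Sublist (List.range' 1 n) := by
    have hp : l.Pairwise (· < ·) := (hc.imp fun _ _ h ↦ h.1).pairwise
    refine List.sublist_of_subperm_of_pairwise (hp.nodup.subperm fun i hi ↦ ?_) hp
      (List.pairwise_lt_range' ..)
    have := hl i hi
    rw [List.mem_range'_1]
    lia
  have hwalk := walkFrom_ofFn_sum (fun i ↦ ζ i ω) 0 n
  simp only [Finset.range_zero, Finset.sum_empty, zero_add] at hwalk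
  have hc' : (l.map fun j ↦ ∑ i ∈ Finset.range j, ζ i ω).IsChain
      fun x y ↦ 2 * (2 * (ε / 4)) < dist x y := by
    rw [List.isChain_map]
    refine hc.imp fun i j hij ↦ ?_
    have := hij.2
    linarith
  have h := chain_length_le_jumpCount (by positivity) 0 (hsub.map _) hc'
  rw [List.length_map, ← hwalk] at h
  simp only [Set.mem_preimage, Set.mem_ofPred_eq]
  lia

end Chains

section Levy

lemma sum_range_eq_sum_range_two_mul {E : Type*} [AddCommMonoid E] {x y : ℕ → E}
    (h : ∀ i, x i = y (2 * i) + y (2 * i + 1)) (n : ℕ) :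
    ∑ k ∈ Finset.range n, x k = ∑ k ∈ Finset.range (2 * n), y k := by
  induction n with
  | zero => simp
  | succ n ih =>
    rw [Finset.sum_range_succ, ih, h, mul_add, mul_one, Finset.sum_range_succ,
      Finset.sum_range_succ, add_assoc]

variable {Ω : Type*} [MeasurableSpace Ω] {Q : Measure Ω} {E : Type*} [NormedAddCommGroup E]
  [InnerProductSpace ℝ E] [CompleteSpace E] [MeasurableSpace E] [BorelSpace E]
  [SecondCountableTopology E] {μ : ℝ≥0 → Measure E} [∀ t, IsProbabilityMeasure (μ t)]

lemma map_sum_pi_eq_of_conv (hconv : ∀ s t, μ (s + t) = μ s ∗ μ t) (k : ℕ) (h : ℝ≥0) :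
    (Measure.pi fun _ : Fin k ↦ μ h).map (fun x ↦ ∑ i, x i) = μ (k * h) := by
  have : IsProbabilityMeasure ((Measure.pi fun _ : Fin k ↦ μ h).map fun x ↦ ∑ i, x i) :=
    Measure.isProbabilityMeasure_map (by fun_prop)
  refine Measure.ext_of_charFun ?_
  rw [charFun_map_sum_pi_eq_prod, charFun_nat_mul_of_conv hconv]
  simp

/-- Almost surely, the dyadic increments of a convolution semigroup have no long chains of large
moves in short dyadic intervals. -/
lemma ae_exists_chain_length_le (hconv : ∀ s t, μ (s + t) = μ s ∗ μ t)
    (htail : ∀ a > 0, Tendsto (fun t ↦ μ t {x | a < ‖x‖}) (𝓝 0) (𝓝 0))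
    {ξ : ℕ → ℕ → Ω → E} (mξ : ∀ m i, Measurable (ξ m i)) (hξ : ∀ m, iIndepFun (ξ m) Q)
    (hlaw : ∀ m i, Q.map (ξ m i) = μ (2⁻¹ ^ m))
    (hc : ∀ᵐ ω ∂Q, ∀ m i, ξ m i ω = ξ (m + 1) (2 * i) ω + ξ (m + 1) (2 * i + 1) ω) :
    ∀ᵐ ω ∂Q, ∀ ε > 0, ∃ r : ℕ, ∀ k : ℕ, ∃ N : ℕ, ∀ m, ∀ l : List ℕ,
      (∀ i ∈ l, k * 2 ^ m < i ∧ i ≤ (k + 1) * 2 ^ m) →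
      (l.IsChain fun i j ↦ i < j ∧ ε < dist (∑ k ∈ Finset.range i, ξ (r + m) k ω)
        (∑ k ∈ Finset.range j, ξ (r + m) k ω)) → l.length ≤ N := by
  suffices H : ∀ ε > 0, ∃ r : ℕ, ∀ k : ℕ, ∀ᵐ ω ∂Q, ∃ N : ℕ, ∀ m, ∀ l : List ℕ,
      (∀ i ∈ l, k * 2 ^ m < i ∧ i ≤ (k + 1) * 2 ^ m) →
      (l.IsChain fun i j ↦ i < j ∧ ε < dist (∑ k ∈ Finset.range i, ξ (r + m) k ω)
        (∑ k ∈ Finset.range j, ξ (r + m) k ω)) → l.length ≤ N by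
    choose! r hr using H
    have h1 : ∀ᵐ ω ∂Q, ∀ n k : ℕ, _ :=
      ae_all_iff.2 fun n : ℕ ↦ ae_all_iff.2 (hr (1 / ((n : ℝ) + 1)) (by positivity))
    filter_upwards [h1] with ω hω ε hε
    obtain ⟨n, hn⟩ := exists_nat_one_div_lt hε
    refine ⟨r (1 / ((n : ℝ) + 1)), fun k ↦ ?_⟩
    obtain ⟨N, hN⟩ := hω n k
    exact ⟨N, fun m l h2 h3 ↦ hN m l h2 (h3.imp fun i j hij ↦ ⟨hij.1, hn.trans hij.2⟩)⟩
  intro ε hε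
  obtain ⟨r, hr⟩ : ∃ r : ℕ, ∀ t ≤ (2⁻¹ : ℝ≥0) ^ r, μ t {x | ε / 4 < ‖x‖} ≤ 4⁻¹ := by
    have h := (htail (ε / 4) (by positivity)).eventually_le_const
      (show (0 : ENNReal) < 4⁻¹ by simp)
    obtain ⟨b, hb, hbt⟩ := (nhds_bot_basis (α := ℝ≥0)).eventually_iff.1 h
    obtain ⟨r, hr⟩ := exists_pow_lt_of_lt_one hb (by norm_num : (2⁻¹ : ℝ≥0) < 1)
    exact ⟨r, fun t ht ↦ hbt (ht.trans_lt hr)⟩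
  refine ⟨r, fun k ↦ ?_⟩
  let A (N m : ℕ) : Set Ω := {ω | (∀ m i, ξ m i ω = ξ (m + 1) (2 * i) ω + ξ (m + 1) (2 * i + 1) ω) ∧
    ∃ l : List ℕ, (∀ i ∈ l, k * 2 ^ m < i ∧ i ≤ (k + 1) * 2 ^ m) ∧
      (l.IsChain fun i j ↦ i < j ∧ ε < dist (∑ k ∈ Finset.range i, ξ (r + m) k ω)
        (∑ k ∈ Finset.range j, ξ (r + m) k ω)) ∧ N + 1 < l.length}
  have hA (N m : ℕ) : Q (A N m) ≤ 2 * 2⁻¹ ^ N := by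
    set K := k * 2 ^ m
    refine (measure_mono ?_).trans (measure_exists_chain_le (ζ := fun i ↦ ξ (r + m) (K + i))
      (fun i ↦ mξ _ _) ((hξ (r + m)).precomp (add_right_injective K)) (fun i ↦ hlaw _ _) hε
      (n := 2 ^ m) ?_ N)
    · rintro ω ⟨-, l, hl, hlc, hlen⟩
      refine ⟨l.map (· - K), ?_, ?_, by simpa using hlen⟩
      · intro i hi
        obtain ⟨j, hj, rfl⟩ := List.mem_map.1 hi
        have := hl j hj
        rw [add_mul, one_mul] at this
        lia
      · rw [List.isChain_map]
        have hK (j : ℕ) (hj : K < j) : ∑ i ∈ Finset.range (j - K), ξ (r + m) (K + i) ω =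
            ∑ i ∈ Finset.range j, ξ (r + m) i ω - ∑ i ∈ Finset.range K, ξ (r + m) i ω := by
          rw [eq_sub_iff_add_eq', ← Finset.sum_range_add, Nat.add_sub_cancel' hj.le]
        refine hlc.imp_of_mem_imp fun i j hi hj hij ↦ ?_
        rw [hK i (hl i hi).1, hK j (hl j hj).1, dist_sub_right]
        exact ⟨by have := (hl i hi).1; lia, hij.2⟩
    · intro j hj
      have h := hr (j * 2⁻¹ ^ (r + m)) (by
        rw [pow_add, mul_left_comm]
        refine mul_le_of_le_one_right' ?_
        rw [inv_pow, ← div_eq_mul_inv, div_le_one (by positivity)]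
        exact_mod_cast hj)
      rwa [← map_sum_pi_eq_of_conv hconv, Measure.map_apply (by fun_prop)
        (measurableSet_lt measurable_const (by fun_prop))] at h
  have hmono (N : ℕ) : Monotone (A N) := by
    refine monotone_nat_of_le_succ fun m ↦ ?_
    rintro ω ⟨hω, l, hl, hlc, hlen⟩
    refine ⟨hω, l.map (2 * ·), ?_, ?_, by simpa using hlen⟩
    · intro i hi
      obtain ⟨j, hj, rfl⟩ := List.mem_map.1 hi
      have := hl j hj
      rw [pow_succ]
      constructor <;> linarith
    · rw [List.isChain_map]
      refine hlc.imp fun i j hij ↦ ⟨by lia, ?_⟩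
      rw [← add_assoc, ← sum_range_eq_sum_range_two_mul (hω (r + m)),
        ← sum_range_eq_sum_range_two_mul (hω (r + m))]
      exact hij.2
  have hnull : Q (⋂ N, ⋃ m, A N m) = 0 := by
    have h1 (N : ℕ) : Q (⋂ N, ⋃ m, A N m) ≤ 2 * 2⁻¹ ^ N := by
      refine (measure_mono (Set.iInter_subset _ N)).trans ?_
      rw [(hmono N).measure_iUnion]
      exact iSup_le (hA N)
    have h2 : Tendsto (fun N : ℕ ↦ (2 : ENNReal) * 2⁻¹ ^ N) atTop (𝓝 (2 * 0)) :=
      ENNReal.Tendsto.const_mul (ENNReal.tendsto_pow_atTop_nhds_zero_of_lt_one (by simp))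
        (.inr (by simp))
    rw [mul_zero] at h2
    exact le_antisymm (ge_of_tendsto' h2 h1) (zero_le)
  filter_upwards [hc, measure_eq_zero_iff_ae_notMem.1 hnull] with ω h1 h2
  simp only [Set.mem_iInter, Set.mem_iUnion, not_forall, not_exists] at h2
  obtain ⟨N, hN⟩ := h2
  refine ⟨N + 1, fun m l hl hlc ↦ ?_⟩
  by_contra! hlen
  exact hN m ⟨h1, l, hl, hlc, hlen⟩

end Levy

section ExistsLevy

lemma isCadlagPath_zero {E : Type*} [TopologicalSpace E] [Zero E] :
    IsCadlagPath fun _ : ℝ≥0 ↦ (0 : E) :=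
  fun _ ↦ ⟨continuousWithinAt_const, 0, tendsto_const_nhds⟩

/-- Every continuous convolution semigroup of probability measures is the family of
one-dimensional marginal laws of a Lévy process. -/
theorem exists_isLevyProcess_of_conv {E : Type} [NormedAddCommGroup E] [InnerProductSpace ℝ E]
    [CompleteSpace E] [SecondCountableTopology E] [MeasurableSpace E] [BorelSpace E]
    {μ : ℝ≥0 → Measure E} [∀ t, IsProbabilityMeasure (μ t)]
    (hconv : ∀ s t, μ (s + t) = μ s ∗ μ t)
    (hcont : ∀ u, Continuous fun t ↦ charFun (μ t) u)
    (htail : ∀ a > 0, Tendsto (fun t ↦ μ t {x | a < ‖x‖}) (𝓝 0) (𝓝 0)) :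
    ∃ (Ω : Type v) (_ : MeasurableSpace Ω) (Q : Measure Ω) (_ : IsProbabilityMeasure Q)
      (Y : ℝ≥0 → Ω → E), IsLevyProcess Y Q ∧ ∀ t, Q.map (Y t) = μ t := by
  obtain ⟨Ω, _, Q, _, ξ, mξ, hξ, hlaw, hc⟩ := exists_dyadic_increments.{v} hconv
  have hgood := hc.and (ae_exists_chain_length_le hconv htail mξ hξ hlaw hc)
  obtain ⟨G, hG, hGm, hGsub⟩ := hgood.exists_measurable_mem
  -- the time index, at level `m`, of the dyadic number just after `t`
  let j (m : ℕ) (t : ℝ≥0) : ℕ := ⌊t * 2 ^ m⌋₊ + 1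
  let S (m : ℕ) (t : ℝ≥0) (ω : Ω) : E := ∑ k ∈ Finset.range (j m t), ξ m k ω
  have mS (m : ℕ) (t : ℝ≥0) : Measurable (S m t) := by
    exact Finset.measurable_sum _ fun k _ ↦ mξ m k
  have hpath (ω : Ω) : ∃ y : ℝ≥0 → E, IsCadlagPath y ∧
      ∀ t, Tendsto (fun m ↦ G.indicator (S m t) ω) atTop (𝓝 (y t)) := by
    by_cases hω : ω ∈ G
    · obtain ⟨h1, h2⟩ := hGsub ω hω
      obtain ⟨y, hy, hyt⟩ := exists_isCadlagPath_of_chain_length_le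
        (s := fun m i ↦ ∑ k ∈ Finset.range i, ξ m k ω)
        (fun m i ↦ sum_range_eq_sum_range_two_mul (h1 m) i) h2
      exact ⟨y, hy, fun t ↦ by simpa [hω] using hyt t⟩
    · exact ⟨fun _ ↦ 0, isCadlagPath_zero, fun t ↦ by simp [hω]⟩
  choose y hy hyt using hpath
  let Y (t : ℝ≥0) (ω : Ω) : E := y ω t
  have mY (t : ℝ≥0) : Measurable (Y t) :=
    measurable_of_tendsto_metrizable (fun m ↦ (mS m t).indicator hGm)
      (tendsto_pi_nhds.2 fun ω ↦ hyt ω t)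
  have hSY : ∀ᵐ ω ∂Q, ∀ t, Tendsto (fun m ↦ S m t ω) atTop (𝓝 (Y t ω)) := by
    filter_upwards [hG] with ω hω t
    simpa [hω] using hyt ω t
  have hj (m : ℕ) : Monotone (j m) := fun s t hst ↦ by
    simp only [j]
    gcongr
  have hjt (t : ℝ≥0) : Tendsto (fun m ↦ (j m t : ℝ≥0) * 2⁻¹ ^ m) atTop (𝓝 t) := by
    simp_rw [inv_pow, ← div_eq_mul_inv]
    exact (tendsto_floor_add_one_div_two_pow t).mono_right nhdsWithin_le_nhds
  have hinc {s t : ℝ≥0} (hst : s ≤ t) (m : ℕ) (ω : Ω) :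
      S m t ω - S m s ω = ∑ k ∈ Finset.Ico (j m s) (j m t), ξ m k ω :=
    (Finset.sum_Ico_eq_sub _ (hj m hst)).symm
  have hSinc {s t : ℝ≥0} (hst : s ≤ t) (m : ℕ) :
      charFun (Q.map fun ω ↦ S m t ω - S m s ω) =
        charFun (μ ((j m t : ℝ≥0) * 2⁻¹ ^ m - j m s * 2⁻¹ ^ m)) := by
    simp_rw [hinc hst]
    rw [charFun_map_finsetSum_eq_pow (mξ m) (hξ m) (hlaw m), ← charFun_nat_mul_of_conv hconv,
      Nat.card_Ico, Nat.cast_tsub, tsub_mul]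
  have hYinc {s t : ℝ≥0} (hst : s ≤ t) : Q.map (fun ω ↦ Y t ω - Y s ω) = μ (t - s) := by
    have : IsProbabilityMeasure (Q.map fun ω ↦ Y t ω - Y s ω) :=
      Measure.isProbabilityMeasure_map (by fun_prop)
    refine Measure.ext_of_charFun (funext fun u ↦ ?_)
    have h1 := tendsto_charFun_of_ae_tendsto (P := Q) (l := atTop)
      (X := fun m ω ↦ S m t ω - S m s ω) (Z := fun ω ↦ Y t ω - Y s ω)
      (fun m ↦ (mS m t).sub (mS m s)) (by fun_prop) (by
        filter_upwards [hSY] with ω hω using (hω t).sub (hω s)) u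
    simp_rw [hSinc hst] at h1
    exact tendsto_nhds_unique h1 (((hcont u).tendsto _).comp ((hjt t).sub (hjt s)))
  have hYlaw (t : ℝ≥0) : Q.map (Y t) = μ t := by
    have : IsProbabilityMeasure (Q.map (Y t)) := Measure.isProbabilityMeasure_map (by fun_prop)
    refine Measure.ext_of_charFun (funext fun u ↦ ?_)
    have h1 := tendsto_charFun_of_ae_tendsto (P := Q) (l := atTop) (X := fun m ↦ S m t) (Z := Y t)
      (fun m ↦ mS m t) (mY t) (by filter_upwards [hSY] with ω hω using hω t) u
    have h2 (m : ℕ) : charFun (Q.map (S m t)) = charFun (μ ((j m t : ℝ≥0) * 2⁻¹ ^ m)) := by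
      rw [charFun_map_finsetSum_eq_pow (mξ m) (hξ m) (hlaw m), ← charFun_nat_mul_of_conv hconv,
        Finset.card_range]
    simp_rw [h2] at h1
    exact tendsto_nhds_unique h1 (((hcont u).tendsto _).comp (hjt t))
  have hY0 : ∀ᵐ ω ∂Q, Y 0 ω = 0 := by
    refine ae_eq_zero_of_charFun_map_eq_one (mY 0) ?_
    rw [hYlaw, charFun_zero_eq_one_of_conv hconv]
  have hYc (ω : Ω) : IsCadlagPath fun t ↦ Y t ω := hy ω
  clear_value S Y j
  refine ⟨Ω, _, Q, inferInstance, Y, ⟨mY, hY0, ?_, ?_, ?_, .of_forall hYc⟩, hYlaw⟩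
  · intro n t ht
    have mV (m : ℕ) (i : Fin n) : Measurable fun ω ↦ S m (t i.succ) ω - S m (t i.castSucc) ω :=
      (mS m _).sub (mS m _)
    have mW (i : Fin n) : Measurable fun ω ↦ Y (t i.succ) ω - Y (t i.castSucc) ω :=
      (mY _).sub (mY _)
    refine iIndepFun_of_ae_tendsto mV mW (fun m ↦ ?_) ?_
    · have hle (i : Fin n) : t i.castSucc ≤ t i.succ := ht i.castSucc_le_succ
      have heq : (fun (i : Fin n) ω ↦ S m (t i.succ) ω - S m (t i.castSucc) ω) = fun i ω ↦
          ∑ k ∈ Finset.Ico (j m (t i.castSucc)) (j m (t i.succ)), ξ m k ω :=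
        funext fun i ↦ funext fun ω ↦ hinc (hle i) m ω
      rw [heq]
      refine iIndepFun.finsetSum (mξ m) (hξ m) ?_
      have key (a b : Fin n) (hab : a < b) : Disjoint
          (Finset.Ico (j m (t a.castSucc)) (j m (t a.succ)))
          (Finset.Ico (j m (t b.castSucc)) (j m (t b.succ))) := by
        have h := hj m (ht (Fin.succ_le_castSucc_iff.2 hab))
        refine Finset.disjoint_left.2 fun k hk hk' ↦ ?_
        rw [Finset.mem_Ico] at hk hk'
        lia
      intro a b hab
      rcases lt_or_gt_of_ne hab with h | h
      · exact key a b h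
      · exact (key b a h).symm
    · filter_upwards [hSY] with ω hω i using (hω _).sub (hω _)
  · intro s t
    refine ⟨by fun_prop, by fun_prop, ?_⟩
    rw [hYinc le_self_add, hYinc zero_le, add_tsub_cancel_left, tsub_zero]
  · intro t
    rw [tendstoInMeasure_iff_norm]
    intro ε hε
    have hdist : Tendsto (fun s ↦ (s - t) + (t - s)) (𝓝 t) (𝓝 0) := by
      have : Continuous fun s : ℝ≥0 ↦ (s - t) + (t - s) := by fun_prop
      simpa using this.tendsto t
    have h1 := (htail (ε / 2) (by positivity)).comp hdist
    refine tendsto_of_tendsto_of_tendsto_of_le_of_le tendsto_const_nhds h1 (fun _ ↦ zero_le)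
      fun s ↦ ?_
    have hm : MeasurableSet {x : E | ε / 2 < ‖x‖} := measurableSet_lt measurable_const (by fun_prop)
    simp only [Function.comp_apply]
    rcases le_total s t with hst | hst
    · rw [tsub_eq_zero_of_le hst, zero_add, ← hYinc hst, Measure.map_apply (by fun_prop) hm]
      refine measure_mono fun ω (hω : ε ≤ ‖Y s ω - Y t ω‖) ↦ ?_
      rw [norm_sub_rev] at hω
      exact (half_lt_self hε).trans_le hω
    · rw [tsub_eq_zero_of_le hst, add_zero, ← hYinc hst, Measure.map_apply (by fun_prop) hm]
      exact measure_mono fun ω hω ↦ (half_lt_self hε).trans_le hω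

end ExistsLevy

section WeaklyIDT

variable {Ω : Type*} [MeasurableSpace Ω] {P : Measure Ω} [IsProbabilityMeasure P]
  {E : Type*} [NormedAddCommGroup E] [InnerProductSpace ℝ E]
  [SecondCountableTopology E] [MeasurableSpace E] [BorelSpace E] {X : ℝ≥0 → Ω → E}

omit [InnerProductSpace ℝ E] in
lemma map_sum_pi_apply {Z : Ω → E} (hZ : Measurable Z) (n : ℕ) :
    (Measure.pi fun _ : Fin n ↦ P).map (fun ω ↦ ∑ i, Z (ω i)) =
      (Measure.pi fun _ : Fin n ↦ P.map Z).map fun x ↦ ∑ i, x i := by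
  have := Measure.isProbabilityMeasure_map (μ := P) hZ.aemeasurable
  rw [← Measure.pi_map_pi fun _ ↦ hZ.aemeasurable, Measure.map_map (by fun_prop) (by fun_prop)]
  rfl

lemma charFun_map_sum_pi_apply {Z : Ω → E} (hZ : Measurable Z) (n : ℕ) :
    charFun ((Measure.pi fun _ : Fin n ↦ P).map fun ω ↦ ∑ i, Z (ω i)) =
      charFun (P.map Z) ^ n := by
  have := Measure.isProbabilityMeasure_map (μ := P) hZ.aemeasurable
  rw [map_sum_pi_apply hZ, charFun_map_sum_pi_eq_prod]
  simp

omit [SecondCountableTopology E] in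
lemma StochasticallyContinuous.continuous_charFun (hX : ∀ t, Measurable (X t))
    (hcont : StochasticallyContinuous X P) (u : E) :
    Continuous fun t ↦ charFun (P.map (X t)) u :=
  continuous_iff_continuousAt.2 fun t ↦ tendsto_charFun_of_tendstoInDistribution
    ((hcont t).tendstoInDistribution fun s ↦ (hX s).aemeasurable) u

lemma IsWeaklyIDT.charFun_nat_mul (hX : ∀ t, Measurable (X t)) (h : IsWeaklyIDT X P) {n : ℕ}
    (hn : 1 ≤ n) (t : ℝ≥0) :
    charFun (P.map (X (n * t))) = charFun (P.map (X t)) ^ n := by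
  rw [(h n hn t).map_eq, charFun_map_sum_pi_apply (hX t)]

lemma IsWeaklyIDT.charFun_zero [CompleteSpace E] (hX : ∀ t, Measurable (X t))
    (h : IsWeaklyIDT X P) : charFun (P.map (X 0)) = 1 := by
  have := Measure.isProbabilityMeasure_map (μ := P) (hX 0).aemeasurable
  refine charFun_eq_one_of_sq_eq _ fun u ↦ ?_
  have h1 := h.charFun_nat_mul hX one_le_two 0
  rw [mul_zero] at h1
  exact (congrFun h1 u).symm

lemma IsWeaklyIDT.charFun_nat_mul' [CompleteSpace E] (hX : ∀ t, Measurable (X t))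
    (h : IsWeaklyIDT X P) (n : ℕ) (t : ℝ≥0) :
    charFun (P.map (X (n * t))) = charFun (P.map (X t)) ^ n := by
  obtain rfl | hn := Nat.eq_zero_or_pos n
  · simp [h.charFun_zero hX]
  · exact h.charFun_nat_mul hX hn t

/-- The marginal laws of a stochastically continuous weakly IDT process form a convolution
semigroup. -/
lemma IsWeaklyIDT.map_add_eq_conv [CompleteSpace E] (hX : ∀ t, Measurable (X t))
    (hcont : StochasticallyContinuous X P) (h : IsWeaklyIDT X P) (s t : ℝ≥0) :
    P.map (X (s + t)) = P.map (X s) ∗ P.map (X t) := by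
  have (t : ℝ≥0) := Measure.isProbabilityMeasure_map (μ := P) (hX t).aemeasurable
  refine Measure.ext_of_charFun (funext fun u ↦ ?_)
  rw [charFun_conv]
  have hφ := hcont.continuous_charFun hX u
  have hlim (t : ℝ≥0) := (tendsto_floor_add_one_div_two_pow t).mono_right nhdsWithin_le_nhds
  refine tendsto_nhds_unique ((hφ.tendsto _).comp ((hlim s).add (hlim t)))
    ((((hφ.tendsto _).comp (hlim s)).mul ((hφ.tendsto _).comp (hlim t))).congr fun m ↦ ?_)
  simp only [Function.comp_apply]
  rw [← add_div, ← Nat.cast_add]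
  simp_rw [div_eq_mul_inv]
  rw [h.charFun_nat_mul' hX, h.charFun_nat_mul' hX, h.charFun_nat_mul' hX]
  simp only [Pi.pow_apply, pow_add]

lemma IsWeaklyIDT.tendsto_measure_norm_gt [CompleteSpace E] (hX : ∀ t, Measurable (X t))
    (hcont : StochasticallyContinuous X P) (h : IsWeaklyIDT X P) {a : ℝ} (ha : 0 < a) :
    Tendsto (fun t ↦ P.map (X t) {x | a < ‖x‖}) (𝓝 0) (𝓝 0) := by
  have h0 : ∀ᵐ ω ∂P, X 0 ω = 0 := ae_eq_zero_of_charFun_map_eq_one (hX 0) (h.charFun_zero hX)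
  have h1 := tendstoInMeasure_iff_norm.1 (hcont 0) a ha
  refine tendsto_of_tendsto_of_tendsto_of_le_of_le tendsto_const_nhds h1 (fun _ ↦ zero_le)
    fun t ↦ ?_
  rw [Measure.map_apply (hX t) (measurableSet_lt measurable_const (by fun_prop))]
  refine measure_mono_ae ?_
  filter_upwards [h0] with ω hω (hlt : a < ‖X t ω‖)
  change a ≤ ‖X t ω - X 0 ω‖
  rw [hω, sub_zero]
  exact hlt.le

lemma IsLevyProcess.charFun_add {Y : ℝ≥0 → Ω → E} (hY : IsLevyProcess Y P) (s t : ℝ≥0) :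
    charFun (P.map (Y (s + t))) = charFun (P.map (Y s)) * charFun (P.map (Y t)) := by
  have mY := hY.measurable
  have h1 := hY.indepIncrements.indepFun_eval_sub (zero_le (a := s)) (le_self_add (b := t))
    hY.zero_ae
  have h2 := h1.charFun_map_add_eq_mul (mY s).aemeasurable ((mY _).sub (mY s)).aemeasurable
  rw [add_sub_cancel] at h2
  rw [h2]
  congr 2
  refine (hY.stationaryIncrements s t).map_eq.trans (Measure.map_congr ?_)
  filter_upwards [hY.zero_ae] with ω hω
  simp [hω]

lemma IsLevyProcess.isWeaklyIDT [CompleteSpace E] {Y : ℝ≥0 → Ω → E} (hY : IsLevyProcess Y P) :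
    IsWeaklyIDT Y P := by
  have mY := hY.measurable
  have hP (t : ℝ≥0) := Measure.isProbabilityMeasure_map (μ := P) (mY t).aemeasurable
  have hpow (n : ℕ) (hn : 1 ≤ n) (t : ℝ≥0) :
      charFun (P.map (Y (n * t))) = charFun (P.map (Y t)) ^ n := by
    induction n, hn using Nat.le_induction with
    | base => simp
    | succ n hn ih => rw [Nat.cast_succ, add_mul, one_mul, hY.charFun_add, ih, pow_succ]
  intro n hn t
  have hm : Measurable fun ω : Fin n → Ω ↦ ∑ i, Y t (ω i) := by fun_prop
  refine ⟨(mY _).aemeasurable, hm.aemeasurable, ?_⟩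
  have := Measure.isProbabilityMeasure_map (μ := Measure.pi fun _ : Fin n ↦ P) hm.aemeasurable
  refine Measure.ext_of_charFun ?_
  rw [hpow n hn, charFun_map_sum_pi_apply (mY t)]

omit [InnerProductSpace ℝ E] in
lemma IsWeaklyIDT.of_areAssociated {Ω' : Type*} [MeasurableSpace Ω'] {Q : Measure Ω'}
    [IsProbabilityMeasure Q] {Y : ℝ≥0 → Ω' → E} (hX : ∀ t, Measurable (X t))
    (hY : ∀ t, Measurable (Y t)) (h : AreAssociated X P Y Q) (hYidt : IsWeaklyIDT Y Q) :
    IsWeaklyIDT X P := by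
  intro n hn t
  have hm : Measurable fun ω : Fin n → Ω ↦ ∑ i, X t (ω i) := by fun_prop
  refine ⟨(hX _).aemeasurable, hm.aemeasurable, ?_⟩
  rw [(h _).map_eq, (hYidt n hn t).map_eq, map_sum_pi_apply (hX t), map_sum_pi_apply (hY t),
    (h t).map_eq]

end WeaklyIDT

/-- The independent copy `X'` of `X` in the second part is realized, together with `X`, on the
product space `Ω × Ω` as `X'_t (ω₁, ω₂) = X_t ω₂`, with `X_s (ω₁, ω₂) = X_s ω₁`. -/
theorem proposition6p5 {d : ℕ} {Ω : Type u} [MeasurableSpace Ω] (P : Measure Ω)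
    [IsProbabilityMeasure P] (X : ℝ≥0 → Ω → EuclideanSpace ℝ (Fin d))
    (hX : ∀ t, Measurable (X t)) (hcont : StochasticallyContinuous X P) :
    (IsWeaklyIDT X P ↔ IsOneLevy.{u, v, 0} X P) ∧
      (IsWeaklyIDT X P → ∀ s t : ℝ≥0,
        IdentDistrib (X (s + t)) (fun ω : Ω × Ω ↦ X s ω.1 + X t ω.2) P (P.prod P)) := by
  refine ⟨⟨fun h ↦ ?_, ?_⟩, fun h s t ↦ ?_⟩
  · have (t : ℝ≥0) := Measure.isProbabilityMeasure_map (μ := P) (hX t).aemeasurable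
    obtain ⟨Ω', _, Q, hQ, Y, hY, hlaw⟩ := exists_isLevyProcess_of_conv.{v}
      (μ := fun t ↦ P.map (X t)) (h.map_add_eq_conv hX hcont) (hcont.continuous_charFun hX)
      fun a ha ↦ h.tendsto_measure_norm_gt hX hcont ha
    exact ⟨Ω', _, Q, hQ, Y, hY,
      fun t ↦ ⟨(hX t).aemeasurable, (hY.measurable t).aemeasurable, (hlaw t).symm⟩⟩
  · rintro ⟨Ω', _, Q, hQ, Y, hY, hXY⟩
    exact hY.isWeaklyIDT.of_areAssociated hX hY.measurable hXY
  · refine ⟨(hX _).aemeasurable, by fun_prop, ?_⟩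
    rw [h.map_add_eq_conv hX hcont, Measure.conv, Measure.map_prod_map _ _ (hX s) (hX t),
      Measure.map_map (by fun_prop) (by fun_prop)]
    rfl
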